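/- Let $I$ be a set and let $\Bbbk$ be a countable (i.e., at most countable) totally ordered division ring, not necessarily commutative. A $\Bbbk$-vector lattice is a left $\Bbbk$-vector space $E$ endowed with a lattice ordering such that $x\le y$ implies $x+z\le y+z$ for all $x,y,z\in E$, and $x\le y$ implies $rx\le ry$ for all $x,y\in E$ and all $0\le r\in\Bbbk$. An $\ell$-ideal of $E$ is a vector subspace $J$ such that $x\in J$ and $|y|\le|x|$ imply $y\in J$; it is principal if it is the least $\ell$-ideal containing some element of $E$. The principal $\ell$-ideals of $E$, ordered by inclusion, form a distributive lattice with least element $0$. Let $F$ be the free $\Bbbk$-vector lattice on $I$, and let $D$ be the lattice of all principal $\ell$-ideals of $F$. Then $D$ is monotone-Cevian; that is, there is a binary operation $\smallsetminus$ on $D$ such that for all $x,x',y,y',z\in D$: - $x\le y\vee(x\smallsetminus y)$ and $(x\smallsetminus y)\wedge(y\smallsetminus x)=0$ (the operation is a deviation); - if $x\le x'$, then $x\smallsetminus y\le x'\smallsetminus y$, and if $y\le y'$, then $x\smallsetminus y'\le x\smallsetminus y$ (it is monotone); - $x\smallsetminus z\le(x\smallsetminus y)\vee(y\smallsetminus z)$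 (it is Cevian). -/

import Mathlib

/-! ### Deviations on distributive lattices with zero -/

/-- A deviation on a distributive lattice with zero. -/
structure IsDeviation {D : Type*} [DistribLattice D] [OrderBot D] (d : D → D → D) : Prop where
  le_sup : ∀ x y, x ≤ y ⊔ d x y
  inf_eq_bot : ∀ x y, d x y ⊓ d y x = ⊥

/-- A binary operation that is left isotone and right antitone. -/
structure IsMonotoneOp {D : Type*} [DistribLattice D] (d : D → D → D) : Prop where
  left_isotone : ∀ x x' y, x ≤ x' → d x y ≤ d x' y
  right_antitone : ∀ x y y', y ≤ y' → d x y' ≤ d x y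

/-- The Cevian property of a binary operation. -/
def IsCevianOp {D : Type*} [DistribLattice D] (d : D → D → D) : Prop :=
  ∀ x y z, d x z ≤ d x y ⊔ d y z

/-- A distributive lattice with zero is monotone-Cevian if it has a deviation that is both
monotone and Cevian. -/
def MonotoneCevian (D : Type*) [DistribLattice D] [OrderBot D] : Prop :=
  ∃ d : D → D → D, IsDeviation d ∧ IsMonotoneOp d ∧ IsCevianOp d

/-! ### Vector lattices and their principal `ℓ`-ideals

A (left) vector lattice over a totally ordered division ring `𝕜` is a left `𝕜`-vector space with
a lattice order, such that translations and multiplications by nonnegative scalars are isotone: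
`[AddCommGroup E] [Lattice E] [IsOrderedAddMonoid E] [Module 𝕜 E] [PosSMulMono 𝕜 E]`. -/

section Ideals

variable {𝕜 : Type*} [DivisionRing 𝕜] [LinearOrder 𝕜] [IsStrictOrderedRing 𝕜]
variable {E : Type*} [AddCommGroup E] [Lattice E] [IsOrderedAddMonoid E] [Module 𝕜 E]

/-- An `ℓ`-ideal of a vector lattice: a vector subspace that is solid (equivalently, an
order-convex vector subspace closed under the lattice operations). -/
def IsLIdeal (J : Submodule 𝕜 E) : Prop :=
  LatticeOrderedAddCommGroup.IsSolid (J : Set E)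

variable (𝕜 E) in
/-- The set of all principal `ℓ`-ideals of a vector lattice, that is, of those `ℓ`-ideals that
are the least `ℓ`-ideal containing some element `a`; it is ordered by inclusion. -/
def PrincipalLIdeal : Type _ :=
  {J : Submodule 𝕜 E // ∃ a : E, IsLeast {K : Submodule 𝕜 E | IsLIdeal K ∧ a ∈ K} J}

instance : PartialOrder (PrincipalLIdeal 𝕜 E) :=
  Subtype.partialOrder _

variable [PosSMulMono 𝕜 E]

theorem abs_smul_le_lattice (c : 𝕜) (x : E) : |c • x| ≤ |c| • |x| := by
  rcases le_total 0 c with hc | hc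
  · rw [abs_of_nonneg hc]
    refine sup_le (smul_le_smul_of_nonneg_left (le_abs_self x) hc) ?_
    rw [← smul_neg]
    exact smul_le_smul_of_nonneg_left (neg_le_abs x) hc
  · rw [abs_of_nonpos hc]
    have hc' : 0 ≤ -c := neg_nonneg.2 hc
    refine sup_le ?_ ?_
    · rw [← neg_smul_neg]
      exact smul_le_smul_of_nonneg_left (neg_le_abs x) hc'
    · rw [← neg_smul]
      exact smul_le_smul_of_nonneg_left (le_abs_self x) hc'

theorem smul_mono_scalar {r s : 𝕜} (h : r ≤ s) {x : E} (hx : 0 ≤ x) : r • x ≤ s • x := by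
  have h1 : 0 ≤ (s - r) • x := smul_nonneg (sub_nonneg.2 h) hx
  rwa [sub_smul, sub_nonneg] at h1

variable (𝕜) in
/-- The elements bounded in absolute value by a nonnegative scalar multiple of `|a|`. -/
def principalLIdeal (a : E) : Submodule 𝕜 E where
  carrier := {x | ∃ r : 𝕜, 0 ≤ r ∧ |x| ≤ r • |a|}
  zero_mem' := ⟨0, le_rfl, by simp⟩
  add_mem' := by
    rintro x y ⟨r, hr, hx⟩ ⟨s, hs, hy⟩
    refine ⟨r + s, add_nonneg hr hs, (abs_add_le x y).trans ?_⟩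
    rw [add_smul]
    exact add_le_add hx hy
  smul_mem' := by
    rintro c x ⟨r, hr, hx⟩
    refine ⟨|c| * r, mul_nonneg (abs_nonneg c) hr, (abs_smul_le_lattice c x).trans ?_⟩
    rw [mul_smul]
    exact smul_le_smul_of_nonneg_left hx (abs_nonneg c)

theorem mem_principalLIdeal {a x : E} :
    x ∈ principalLIdeal 𝕜 a ↔ ∃ r : 𝕜, 0 ≤ r ∧ |x| ≤ r • |a| := Iff.rfl

theorem self_mem_principalLIdeal (a : E) : a ∈ principalLIdeal 𝕜 a :=
  ⟨1, zero_le_one, by simp⟩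

theorem isLeast_principalLIdeal (a : E) :
    IsLeast {K : Submodule 𝕜 E | IsLIdeal K ∧ a ∈ K} (principalLIdeal 𝕜 a) := by
  refine ⟨⟨?_, self_mem_principalLIdeal a⟩, ?_⟩
  · rintro x ⟨r, hr, hx⟩ y hy
    exact ⟨r, hr, hy.trans hx⟩
  · rintro K ⟨hK, ha⟩ x ⟨r, hr, hx⟩
    have h1 : |a| ∈ K := hK ha (by rw [abs_abs])
    refine hK (K.smul_mem r h1) (hx.trans (le_abs_self _))

theorem principalLIdeal_le_iff {a b : E} :
    principalLIdeal 𝕜 a ≤ principalLIdeal 𝕜 b ↔ ∃ r : 𝕜, 0 ≤ r ∧ |a| ≤ r • |b| :=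
  ⟨fun h => h (self_mem_principalLIdeal a), fun h =>
    (isLeast_principalLIdeal a).2 ⟨(isLeast_principalLIdeal b).1.1, h⟩⟩

theorem principalLIdeal_abs (a : E) : principalLIdeal 𝕜 |a| = principalLIdeal 𝕜 a := by
  ext x
  simp [mem_principalLIdeal]

namespace PrincipalLIdeal

variable (𝕜) in
/-- The principal `ℓ`-ideal generated by an element. -/
def mk (a : E) : PrincipalLIdeal 𝕜 E := ⟨principalLIdeal 𝕜 a, a, isLeast_principalLIdeal a⟩

theorem mk_le_mk {a b : E} : mk 𝕜 a ≤ mk 𝕜 b ↔ ∃ r : 𝕜, 0 ≤ r ∧ |a| ≤ r • |b| :=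
  principalLIdeal_le_iff

theorem exists_eq_mk (J : PrincipalLIdeal 𝕜 E) : ∃ a : E, 0 ≤ a ∧ mk 𝕜 a = J := by
  obtain ⟨J, a, ha⟩ := J
  refine ⟨|a|, abs_nonneg a, Subtype.ext ?_⟩
  exact (principalLIdeal_abs a).trans ((isLeast_principalLIdeal a).unique ha)

/-- A nonnegative generator of a principal `ℓ`-ideal. -/
noncomputable def gen (J : PrincipalLIdeal 𝕜 E) : E := (exists_eq_mk J).choose

theorem gen_nonneg (J : PrincipalLIdeal 𝕜 E) : 0 ≤ gen J := (exists_eq_mk J).choose_spec.1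

theorem mk_gen (J : PrincipalLIdeal 𝕜 E) : mk 𝕜 (gen J) = J := (exists_eq_mk J).choose_spec.2

theorem mk_le_mk_of_le {a b : E} (ha : 0 ≤ a) (h : a ≤ b) : mk 𝕜 a ≤ mk 𝕜 b :=
  mk_le_mk.2 ⟨1, zero_le_one, by rwa [one_smul, abs_of_nonneg ha, abs_of_nonneg (ha.trans h)]⟩

theorem isLUB_mk_sup {a b : E} (ha : 0 ≤ a) (hb : 0 ≤ b) :
    IsLUB {mk 𝕜 a, mk 𝕜 b} (mk 𝕜 (a ⊔ b)) := by
  refine ⟨?_, ?_⟩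
  · rintro J (rfl | rfl)
    · exact mk_le_mk_of_le ha le_sup_left
    · exact mk_le_mk_of_le hb le_sup_right
  · intro J hJ
    obtain ⟨c, hc, rfl⟩ := exists_eq_mk J
    obtain ⟨r, hr, h1⟩ := mk_le_mk.1 (hJ (Or.inl rfl))
    obtain ⟨s, hs, h2⟩ := mk_le_mk.1 (hJ (Or.inr rfl))
    rw [abs_of_nonneg ha] at h1
    rw [abs_of_nonneg hb] at h2
    refine mk_le_mk.2 ⟨max r s, hr.trans (le_max_left r s), ?_⟩
    rw [abs_of_nonneg (ha.trans le_sup_left)]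
    exact sup_le (h1.trans (smul_mono_scalar (le_max_left r s) (abs_nonneg c)))
      (h2.trans (smul_mono_scalar (le_max_right r s) (abs_nonneg c)))

theorem isGLB_mk_inf {a b : E} (ha : 0 ≤ a) (hb : 0 ≤ b) :
    IsGLB {mk 𝕜 a, mk 𝕜 b} (mk 𝕜 (a ⊓ b)) := by
  refine ⟨?_, ?_⟩
  · rintro J (rfl | rfl)
    · exact mk_le_mk_of_le (le_inf ha hb) inf_le_left
    · exact mk_le_mk_of_le (le_inf ha hb) inf_le_right
  · intro J hJ
    obtain ⟨c, hc, rfl⟩ := exists_eq_mk J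
    obtain ⟨r, hr, h1⟩ := mk_le_mk.1 (hJ (Or.inl rfl))
    obtain ⟨s, hs, h2⟩ := mk_le_mk.1 (hJ (Or.inr rfl))
    rw [abs_of_nonneg ha] at h1
    rw [abs_of_nonneg hb] at h2
    have ht : (0 : 𝕜) < max r s + 1 :=
      add_pos_of_nonneg_of_pos (hr.trans (le_max_left r s)) zero_lt_one
    have hrt : r ≤ max r s + 1 := (le_max_left r s).trans (le_add_of_nonneg_right zero_le_one)
    have hst : s ≤ max r s + 1 := (le_max_right r s).trans (le_add_of_nonneg_right zero_le_one)
    have h3 := h1.trans (smul_mono_scalar hrt ha)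
    have h4 := h2.trans (smul_mono_scalar hst hb)
    have hinv : (0 : 𝕜) ≤ (max r s + 1)⁻¹ := inv_nonneg.2 ht.le
    have h5 := smul_le_smul_of_nonneg_left h3 hinv
    have h6 := smul_le_smul_of_nonneg_left h4 hinv
    rw [inv_smul_smul₀ ht.ne'] at h5 h6
    refine mk_le_mk.2 ⟨max r s + 1, ht.le, ?_⟩
    rw [abs_of_nonneg (le_inf ha hb)]
    have h7 := smul_le_smul_of_nonneg_left (le_inf h5 h6) ht.le
    rwa [smul_inv_smul₀ ht.ne'] at h7

noncomputable instance : Lattice (PrincipalLIdeal 𝕜 E) where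
  sup J K := mk 𝕜 (gen J ⊔ gen K)
  inf J K := mk 𝕜 (gen J ⊓ gen K)
  le_sup_left J K := by
    have h := (isLUB_mk_sup (𝕜 := 𝕜) (gen_nonneg J) (gen_nonneg K)).1
    rw [mk_gen, mk_gen] at h
    exact h (Or.inl rfl)
  le_sup_right J K := by
    have h := (isLUB_mk_sup (𝕜 := 𝕜) (gen_nonneg J) (gen_nonneg K)).1
    rw [mk_gen, mk_gen] at h
    exact h (Or.inr rfl)
  sup_le J K L h1 h2 := by
    have h := (isLUB_mk_sup (𝕜 := 𝕜) (gen_nonneg J) (gen_nonneg K)).2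
    rw [mk_gen, mk_gen] at h
    refine h ?_
    rintro M (rfl | rfl)
    · exact h1
    · exact h2
  inf_le_left J K := by
    have h := (isGLB_mk_inf (𝕜 := 𝕜) (gen_nonneg J) (gen_nonneg K)).1
    rw [mk_gen, mk_gen] at h
    exact h (Or.inl rfl)
  inf_le_right J K := by
    have h := (isGLB_mk_inf (𝕜 := 𝕜) (gen_nonneg J) (gen_nonneg K)).1
    rw [mk_gen, mk_gen] at h
    exact h (Or.inr rfl)
  le_inf L J K h1 h2 := by
    have h := (isGLB_mk_inf (𝕜 := 𝕜) (gen_nonneg J) (gen_nonneg K)).2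
    rw [mk_gen, mk_gen] at h
    refine h ?_
    rintro M (rfl | rfl)
    · exact h1
    · exact h2

theorem mk_sup_mk {a b : E} (ha : 0 ≤ a) (hb : 0 ≤ b) : mk 𝕜 a ⊔ mk 𝕜 b = mk 𝕜 (a ⊔ b) :=
  isLUB_pair.unique (isLUB_mk_sup ha hb)

theorem mk_inf_mk {a b : E} (ha : 0 ≤ a) (hb : 0 ≤ b) : mk 𝕜 a ⊓ mk 𝕜 b = mk 𝕜 (a ⊓ b) :=
  isGLB_pair.unique (isGLB_mk_inf ha hb)

noncomputable instance : DistribLattice (PrincipalLIdeal 𝕜 E) :=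
  DistribLattice.ofInfSupLe fun J K L => by
    obtain ⟨a, ha, rfl⟩ := exists_eq_mk J
    obtain ⟨b, hb, rfl⟩ := exists_eq_mk K
    obtain ⟨c, hc, rfl⟩ := exists_eq_mk L
    have key : a ⊓ (b ⊔ c) = a ⊓ b ⊔ a ⊓ c :=
      letI := AddCommGroup.toDistribLattice E
      inf_sup_left a b c
    rw [mk_sup_mk hb hc, mk_inf_mk ha (hb.trans le_sup_left), mk_inf_mk ha hb, mk_inf_mk ha hc,
      mk_sup_mk (le_inf ha hb) (le_inf ha hc), key]

instance : OrderBot (PrincipalLIdeal 𝕜 E) where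
  bot := mk 𝕜 0
  bot_le J := by
    obtain ⟨a, ha, rfl⟩ := exists_eq_mk J
    exact mk_le_mk_of_le le_rfl ha

end PrincipalLIdeal

end Ideals

/-! ### The free vector lattice on a set

It is the algebra of all vector lattice terms with variables in `I`, modulo the congruence
generated by the identities that define vector lattices. -/

/-- Vector lattice terms with variables in `I`. -/
inductive VLTerm (𝕜 : Type*) (I : Type*) : Type _
  | var : I → VLTerm 𝕜 I
  | zero : VLTerm 𝕜 I
  | neg : VLTerm 𝕜 I → VLTerm 𝕜 I
  | add : VLTerm 𝕜 I → VLTerm 𝕜 I → VLTerm 𝕜 I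
  | smul : 𝕜 → VLTerm 𝕜 I → VLTerm 𝕜 I
  | sup : VLTerm 𝕜 I → VLTerm 𝕜 I → VLTerm 𝕜 I
  | inf : VLTerm 𝕜 I → VLTerm 𝕜 I → VLTerm 𝕜 I

namespace VLTerm

/-- The congruence on terms generated by the identities of vector lattices. -/
inductive Rel (𝕜 : Type*) [DivisionRing 𝕜] [LinearOrder 𝕜] (I : Type*) :
    VLTerm 𝕜 I → VLTerm 𝕜 I → Prop
  -- equivalence relation
  | refl (a) : Rel 𝕜 I a a
  | symm {a b} : Rel 𝕜 I a b → Rel 𝕜 I b a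
  | trans {a b c} : Rel 𝕜 I a b → Rel 𝕜 I b c → Rel 𝕜 I a c
  -- compatibility with the operations
  | neg_congr {a a'} : Rel 𝕜 I a a' → Rel 𝕜 I (neg a) (neg a')
  | add_congr {a a' b b'} : Rel 𝕜 I a a' → Rel 𝕜 I b b' → Rel 𝕜 I (add a b) (add a' b')
  | smul_congr (r : 𝕜) {a a'} : Rel 𝕜 I a a' → Rel 𝕜 I (smul r a) (smul r a')
  | sup_congr {a a' b b'} : Rel 𝕜 I a a' → Rel 𝕜 I b b' → Rel 𝕜 I (sup a b) (sup a' b')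
  | inf_congr {a a' b b'} : Rel 𝕜 I a a' → Rel 𝕜 I b b' → Rel 𝕜 I (inf a b) (inf a' b')
  -- left vector space
  | add_assoc (a b c) : Rel 𝕜 I (add (add a b) c) (add a (add b c))
  | add_comm (a b) : Rel 𝕜 I (add a b) (add b a)
  | zero_add (a) : Rel 𝕜 I (add zero a) a
  | neg_add_cancel (a) : Rel 𝕜 I (add (neg a) a) zero
  | one_smul (a) : Rel 𝕜 I (smul 1 a) a
  | mul_smul (r s : 𝕜) (a) : Rel 𝕜 I (smul (r * s) a) (smul r (smul s a))
  | smul_add (r : 𝕜) (a b) : Rel 𝕜 I (smul r (add a b)) (add (smul r a) (smul r b))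
  | add_smul (r s : 𝕜) (a) : Rel 𝕜 I (smul (r + s) a) (add (smul r a) (smul s a))
  -- lattice
  | sup_comm (a b) : Rel 𝕜 I (sup a b) (sup b a)
  | sup_assoc (a b c) : Rel 𝕜 I (sup (sup a b) c) (sup a (sup b c))
  | inf_comm (a b) : Rel 𝕜 I (inf a b) (inf b a)
  | inf_assoc (a b c) : Rel 𝕜 I (inf (inf a b) c) (inf a (inf b c))
  | sup_inf_self (a b) : Rel 𝕜 I (sup a (inf a b)) a
  | inf_sup_self (a b) : Rel 𝕜 I (inf a (sup a b)) a
  -- translations and multiplications by nonnegative scalars are isotone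
  | add_sup (a b c) : Rel 𝕜 I (add a (sup b c)) (sup (add a b) (add a c))
  | smul_sup (r : 𝕜) (a b) : 0 ≤ r → Rel 𝕜 I (smul r (sup a b)) (sup (smul r a) (smul r b))

end VLTerm

section Free

variable (𝕜 : Type*) [DivisionRing 𝕜] [LinearOrder 𝕜] (I : Type*)

/-- Equality of vector lattice terms modulo the identities of vector lattices. -/
def VLTerm.setoid : Setoid (VLTerm 𝕜 I) where
  r := VLTerm.Rel 𝕜 I
  iseqv := ⟨.refl, .symm, .trans⟩

/-- The free `𝕜`-vector lattice on the set `I`. -/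
def FreeVectorLattice : Type _ := Quotient (VLTerm.setoid 𝕜 I)

namespace FreeVectorLattice

variable {𝕜 I}

/-- The class of a term. -/
def mk (t : VLTerm 𝕜 I) : FreeVectorLattice 𝕜 I := Quotient.mk (VLTerm.setoid 𝕜 I) t

variable (𝕜) in
/-- The canonical generators. -/
def of (i : I) : FreeVectorLattice 𝕜 I := mk (.var i)

theorem mk_eq {s t : VLTerm 𝕜 I} (h : VLTerm.Rel 𝕜 I s t) : mk s = mk t := Quotient.sound h

theorem ind {p : FreeVectorLattice 𝕜 I → Prop} (h : ∀ t, p (mk t)) (x) : p x :=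
  Quotient.inductionOn x h

instance : Zero (FreeVectorLattice 𝕜 I) := ⟨mk .zero⟩

instance : Neg (FreeVectorLattice 𝕜 I) :=
  ⟨Quotient.map VLTerm.neg fun _ _ h => VLTerm.Rel.neg_congr h⟩

instance : Add (FreeVectorLattice 𝕜 I) :=
  ⟨Quotient.map₂ VLTerm.add fun _ _ h _ _ h' => VLTerm.Rel.add_congr h h'⟩

instance : SMul 𝕜 (FreeVectorLattice 𝕜 I) :=
  ⟨fun r => Quotient.map (VLTerm.smul r) fun _ _ h => VLTerm.Rel.smul_congr r h⟩

/-- The join operation. -/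
protected def sup : FreeVectorLattice 𝕜 I → FreeVectorLattice 𝕜 I → FreeVectorLattice 𝕜 I :=
  Quotient.map₂ VLTerm.sup fun _ _ h _ _ h' => VLTerm.Rel.sup_congr h h'

/-- The meet operation. -/
protected def inf : FreeVectorLattice 𝕜 I → FreeVectorLattice 𝕜 I → FreeVectorLattice 𝕜 I :=
  Quotient.map₂ VLTerm.inf fun _ _ h _ _ h' => VLTerm.Rel.inf_congr h h'

instance : AddCommGroup (FreeVectorLattice 𝕜 I) :=
  { AddGroup.ofLeftAxioms
      (fun a b c => by
        induction a using ind; induction b using ind; induction c using ind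
        exact mk_eq (.add_assoc _ _ _))
      (fun a => by
        induction a using ind
        exact mk_eq (.zero_add _))
      (fun a => by
        induction a using ind
        exact mk_eq (.neg_add_cancel _)) with
    add_comm := fun a b => by
      induction a using ind; induction b using ind
      exact mk_eq (.add_comm _ _) }

theorem smul_add' (r : 𝕜) (x y : FreeVectorLattice 𝕜 I) : r • (x + y) = r • x + r • y := by
  induction x using ind; induction y using ind
  exact mk_eq (.smul_add _ _ _)

theorem add_smul' (r s : 𝕜) (x : FreeVectorLattice 𝕜 I) : (r + s) • x = r • x + s • x := by
  induction x using ind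
  exact mk_eq (.add_smul _ _ _)

instance : Module 𝕜 (FreeVectorLattice 𝕜 I) where
  one_smul x := by
    induction x using ind
    exact mk_eq (.one_smul _)
  mul_smul r s x := by
    induction x using ind
    exact mk_eq (.mul_smul _ _ _)
  smul_add := smul_add'
  add_smul := add_smul'
  smul_zero r := by
    have h := smul_add' r (0 : FreeVectorLattice 𝕜 I) 0
    rw [add_zero] at h
    exact left_eq_add.1 h
  zero_smul x := by
    have h := add_smul' (0 : 𝕜) 0 x
    rw [add_zero] at h
    exact left_eq_add.1 h

instance : Lattice (FreeVectorLattice 𝕜 I) :=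
  @Lattice.mk' _ ⟨FreeVectorLattice.sup⟩ ⟨FreeVectorLattice.inf⟩
    (fun a b => by
      induction a using ind; induction b using ind
      exact mk_eq (.sup_comm _ _))
    (fun a b c => by
      induction a using ind; induction b using ind; induction c using ind
      exact mk_eq (.sup_assoc _ _ _))
    (fun a b => by
      induction a using ind; induction b using ind
      exact mk_eq (.inf_comm _ _))
    (fun a b c => by
      induction a using ind; induction b using ind; induction c using ind
      exact mk_eq (.inf_assoc _ _ _))
    (fun a b => by
      induction a using ind; induction b using ind
      exact mk_eq (.sup_inf_self _ _))
    (fun a b => by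
      induction a using ind; induction b using ind
      exact mk_eq (.inf_sup_self _ _))

theorem add_sup' (x y z : FreeVectorLattice 𝕜 I) : x + (y ⊔ z) = (x + y) ⊔ (x + z) := by
  induction x using ind; induction y using ind; induction z using ind
  exact mk_eq (.add_sup _ _ _)

theorem smul_sup' {r : 𝕜} (hr : 0 ≤ r) (x y : FreeVectorLattice 𝕜 I) :
    r • (x ⊔ y) = r • x ⊔ r • y := by
  induction x using ind; induction y using ind
  exact mk_eq (.smul_sup _ _ _ hr)

instance : IsOrderedAddMonoid (FreeVectorLattice 𝕜 I) where
  add_le_add_left a b h c := by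
    rw [add_comm a c, add_comm b c, ← sup_eq_right, ← add_sup', sup_eq_right.2 h]

instance : PosSMulMono 𝕜 (FreeVectorLattice 𝕜 I) where
  smul_le_smul_of_nonneg_left r hr a b h := by
    rw [← sup_eq_right, ← smul_sup' hr, sup_eq_right.2 h]

/-- The value of a term in a vector lattice. -/
def eval {V : Type*} [AddCommGroup V] [Lattice V] [Module 𝕜 V] (f : I → V) : VLTerm 𝕜 I → V
  | .var i => f i
  | .zero => 0
  | .neg a => -eval f a
  | .add a b => eval f a + eval f b
  | .smul r a => r • eval f a
  | .sup a b => eval f a ⊔ eval f b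
  | .inf a b => eval f a ⊓ eval f b

theorem eval_eq [IsStrictOrderedRing 𝕜] {V : Type*} [AddCommGroup V] [Lattice V] [IsOrderedAddMonoid V] [Module 𝕜 V]
    [PosSMulMono 𝕜 V] (f : I → V) {s t : VLTerm 𝕜 I} (h : VLTerm.Rel 𝕜 I s t) :
    eval f s = eval f t := by
  induction h with
  | refl => rfl
  | symm _ ih => exact ih.symm
  | trans _ _ ih1 ih2 => exact ih1.trans ih2
  | neg_congr _ ih => simp only [eval, ih]
  | add_congr _ _ ih1 ih2 => simp only [eval, ih1, ih2]
  | smul_congr r _ ih => simp only [eval, ih]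
  | sup_congr _ _ ih1 ih2 => simp only [eval, ih1, ih2]
  | inf_congr _ _ ih1 ih2 => simp only [eval, ih1, ih2]
  | add_assoc => exact add_assoc _ _ _
  | add_comm => exact add_comm _ _
  | zero_add => exact zero_add _
  | neg_add_cancel => exact neg_add_cancel _
  | one_smul => exact one_smul _ _
  | mul_smul => exact mul_smul _ _ _
  | smul_add => exact smul_add _ _ _
  | add_smul => exact add_smul _ _ _
  | sup_comm => exact sup_comm _ _
  | sup_assoc => exact sup_assoc _ _ _
  | inf_comm => exact inf_comm _ _
  | inf_assoc => exact inf_assoc _ _ _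
  | sup_inf_self => exact sup_inf_self
  | inf_sup_self => exact inf_sup_self
  | add_sup => exact add_sup _ _ _
  | smul_sup r a b hr =>
    simp only [eval]
    rcases hr.eq_or_lt with rfl | hr
    · simp
    · apply le_antisymm
      · have hinv : (0 : 𝕜) ≤ r⁻¹ := inv_nonneg.2 hr.le
        have h1 : ∀ x y : V, r • x ≤ y → x ≤ r⁻¹ • y := fun x y hxy => by
          have := smul_le_smul_of_nonneg_left hxy hinv
          rwa [inv_smul_smul₀ hr.ne'] at this
        have h2 := smul_le_smul_of_nonneg_left
          (sup_le (h1 _ _ le_sup_left) (h1 (eval f b) (r • eval f a ⊔ r • eval f b) le_sup_right))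
          hr.le
        rwa [smul_inv_smul₀ hr.ne'] at h2
      · exact sup_le (smul_le_smul_of_nonneg_left le_sup_left hr.le)
          (smul_le_smul_of_nonneg_left le_sup_right hr.le)

/-- The universal property of the free vector lattice. -/
theorem existsUnique_hom [IsStrictOrderedRing 𝕜] {V : Type*} [AddCommGroup V] [Lattice V] [IsOrderedAddMonoid V]
    [Module 𝕜 V] [PosSMulMono 𝕜 V] (f : I → V) :
    ∃! φ : FreeVectorLattice 𝕜 I →ₗ[𝕜] V,
      (∀ x y, φ (x ⊔ y) = φ x ⊔ φ y) ∧ (∀ x y, φ (x ⊓ y) = φ x ⊓ φ y) ∧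
        ∀ i, φ (of 𝕜 i) = f i := by
  refine ⟨{ toFun := Quotient.lift (eval f) fun _ _ h => eval_eq f h
            map_add' := ?_
            map_smul' := ?_ }, ⟨?_, ?_, fun _ => rfl⟩, ?_⟩
  · intro x y
    induction x using ind; induction y using ind
    rfl
  · intro r x
    induction x using ind
    rfl
  · intro x y
    induction x using ind; induction y using ind
    rfl
  · intro x y
    induction x using ind; induction y using ind
    rfl
  · rintro ψ ⟨h1, h2, h3⟩
    ext x
    induction x using ind with | h t => ?_
    change ψ (mk t) = eval f t
    induction t with
    | var i => exact h3 i
    | zero => exact map_zero ψ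
    | neg a ih => exact (map_neg ψ (mk a)).trans (congrArg _ ih)
    | add a b iha ihb => exact (map_add ψ (mk a) (mk b)).trans (congrArg₂ _ iha ihb)
    | smul r a ih => exact (map_smul ψ r (mk a)).trans (congrArg _ ih)
    | sup a b iha ihb => exact (h1 (mk a) (mk b)).trans (congrArg₂ _ iha ihb)
    | inf a b iha ihb => exact (h2 (mk a) (mk b)).trans (congrArg₂ _ iha ihb)

end FreeVectorLattice

end Free

/-! Suppose each principal `ℓ`-ideal `J` has a nonnegative generator `γ J` that is isotone in `J`.
Then the ideal generated by `(γ J - γ K) ⊔ 0` serves as the difference of `J` and `K`: the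
deviation, monotonicity and Cevian properties follow from elementary facts about positive parts,
such as `(a - c)⁺ ≤ (a - b)⁺ + (b - c)⁺`.

To find `γ`, view the free vector lattice as a lattice of functions on `I → 𝕜`, with pointwise order
(`nonneg_of_evalAt_nonneg`). For a generator `x ≥ 0` of `J`, let `γ J` be the supremum-norm distance
to the zero set of `x`. If `x ≤ r • y`, the zero set of `y` lies in that of `x`, so the distance for
`x` is the smaller one (`IsDist.mono`). The distance generates the same ideal as `x`: `x` is bounded
by a multiple of it because `x` is Lipschitz, and `exists_isDist` gives the reverse bound.

It remains to see that the distance belongs to the free vector lattice. For a finite join of linear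
forms, the set where it is nonpositive is polyhedral, and Fourier–Motzkin elimination of the nearby
point exhibits the distance as a finite join of linear forms and `0`. Every element is a finite meet
of such joins, and meets of functions give unions of sets, hence meets of distances. -/

/-! ### Fourier–Motzkin elimination -/

section Elimination

variable {𝕜 : Type*} [DivisionRing 𝕜] [LinearOrder 𝕜] [IsStrictOrderedRing 𝕜]
variable {V : Type*} [AddCommGroup V] [Module 𝕜 V]

/-- Combinations of elements of `S` with nonnegative coefficients. -/
inductive NonnegComb (𝕜 : Type*) [DivisionRing 𝕜] [LinearOrder 𝕜] {V : Type*} [AddCommGroup V]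
    [Module 𝕜 V] (S : Set V) : V → Prop
  | mem {v} : v ∈ S → NonnegComb 𝕜 S v
  | add {v w} : NonnegComb 𝕜 S v → NonnegComb 𝕜 S w → NonnegComb 𝕜 S (v + w)
  | smul {c : 𝕜} {v} : 0 ≤ c → NonnegComb 𝕜 S v → NonnegComb 𝕜 S (c • v)

theorem NonnegComb.trans {S T : Set V} (h : ∀ v ∈ T, NonnegComb 𝕜 S v) {v : V}
    (hv : NonnegComb 𝕜 T v) : NonnegComb 𝕜 S v := by
  induction hv with
  | mem hv => exact h _ hv
  | add _ _ h1 h2 => exact h1.add h2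
  | smul hc _ h1 => exact h1.smul hc

theorem NonnegComb.map_nonpos {S : Set V} {p : V →ₗ[𝕜] 𝕜} (h : ∀ v ∈ S, p v ≤ 0) {v : V}
    (hv : NonnegComb 𝕜 S v) : p v ≤ 0 := by
  induction hv with
  | mem hv => exact h _ hv
  | add _ _ h1 h2 => rw [map_add]; exact add_nonpos h1 h2
  | smul hc _ h1 => rw [map_smul]; exact mul_nonpos_of_nonneg_of_nonpos hc h1

theorem Finset.exists_forall_le_forall_ge {α : Type*} [LinearOrder α] [Nonempty α]
    (A B : Finset α) (h : ∀ a ∈ A, ∀ b ∈ B, a ≤ b) :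
    ∃ y, (∀ a ∈ A, a ≤ y) ∧ ∀ b ∈ B, y ≤ b := by
  rcases A.eq_empty_or_nonempty with rfl | hA
  · rcases B.eq_empty_or_nonempty with rfl | hB
    · exact ⟨Classical.arbitrary α, by simp, by simp⟩
    · exact ⟨B.min' hB, by simp, fun b hb => B.min'_le b hb⟩
  · exact ⟨A.max' hA, fun a ha => A.le_max' a ha, h _ (A.max'_mem hA)⟩

/-- Elimination of a single variable. -/
theorem exists_elimination_of_le_sup_span (W : Submodule 𝕜 V) (v : V) (S : Finset V)
    (hS : ∀ s ∈ S, s ∈ W ⊔ 𝕜 ∙ v) :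
    ∃ S' : Finset V, (∀ s ∈ S', s ∈ W ∧ NonnegComb 𝕜 (S : Set V) s) ∧
      ∀ p : V →ₗ[𝕜] 𝕜, (∀ s ∈ S', p s ≤ 0) →
        ∃ q : V →ₗ[𝕜] 𝕜, (∀ w ∈ W, q w = p w) ∧ ∀ s ∈ S, q s ≤ 0 := by
  classical
  by_cases hv : v ∈ W
  · have hW : W ⊔ 𝕜 ∙ v = W := by simpa using hv
    rw [hW] at hS
    exact ⟨S, fun s hs => ⟨hS s hs, .mem hs⟩, fun p hp => ⟨p, fun _ _ => rfl, hp⟩⟩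
  -- `φ` reads off the coefficient of the eliminated variable `v`.
  obtain ⟨φ, hφv, hφW⟩ : ∃ φ : V →ₗ[𝕜] 𝕜, φ v = 1 ∧ ∀ w ∈ W, φ w = 0 := by
    obtain ⟨f, hf, hfW⟩ := W.exists_le_ker_of_notMem hv
    refine ⟨(LinearMap.toSpanSingleton 𝕜 𝕜 (f v)⁻¹).comp f, by simp [hf], fun w hw => ?_⟩
    have : f w = 0 := hfW hw
    simp [this]
  have hmem : ∀ s ∈ W ⊔ 𝕜 ∙ v, φ s = 0 → s ∈ W := by
    intro s hs h0
    obtain ⟨w, hw, u, hu, rfl⟩ := Submodule.mem_sup.1 hs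
    obtain ⟨c, rfl⟩ := Submodule.mem_span_singleton.1 hu
    rw [map_add, hφW w hw, map_smul, hφv, zero_add, smul_eq_mul, mul_one] at h0
    simpa [h0] using hw
  set Sp := S.filter fun s => 0 < φ s
  set Sn := S.filter fun s => φ s < 0
  -- Each pair with opposite signs is scaled to coefficients `-1` and `1`, so that `v` cancels in
  -- the sum.
  refine ⟨(S.filter fun s => φ s = 0) ∪
    (Sn ×ˢ Sp).image fun x => (-φ x.1)⁻¹ • x.1 + (φ x.2)⁻¹ • x.2, ?_, ?_⟩
  · intro s hs
    rcases Finset.mem_union.1 hs with hs | hs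
    · obtain ⟨h1, h2⟩ := Finset.mem_filter.1 hs
      exact ⟨hmem s (hS s h1) h2, .mem h1⟩
    · obtain ⟨⟨x, y⟩, hxy, rfl⟩ := Finset.mem_image.1 hs
      obtain ⟨hx, hy⟩ := Finset.mem_product.1 hxy
      obtain ⟨hx, hx'⟩ := Finset.mem_filter.1 hx
      obtain ⟨hy, hy'⟩ := Finset.mem_filter.1 hy
      dsimp only at *
      refine ⟨hmem _ (add_mem (Submodule.smul_mem _ _ (hS x hx))
        (Submodule.smul_mem _ _ (hS y hy))) ?_, ?_⟩
      · simp [inv_neg, inv_mul_cancel₀ hx'.ne, inv_mul_cancel₀ hy'.ne']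
      · exact .add (.smul (inv_nonneg.2 (neg_nonneg.2 hx'.le)) (.mem hx))
          (.smul (inv_nonneg.2 hy'.le) (.mem hy))
  · intro p hp
    -- `y` is the correction to the value of `p` at `v`. Vectors with `φ s < 0` bound it from below,
    -- those with `φ s > 0` from above; the paired inequalities say that these bounds are
    -- compatible.
    obtain ⟨y, hy1, hy2⟩ := Finset.exists_forall_le_forall_ge
      (Sn.image fun s => (-φ s)⁻¹ * p s) (Sp.image fun s => -((φ s)⁻¹ * p s)) (by
        intro a ha b hb
        obtain ⟨s, hs, rfl⟩ := Finset.mem_image.1 ha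
        obtain ⟨s', hs', rfl⟩ := Finset.mem_image.1 hb
        have := hp ((-φ s)⁻¹ • s + (φ s')⁻¹ • s') (Finset.mem_union_right _
          (Finset.mem_image.2 ⟨(s, s'), Finset.mem_product.2 ⟨hs, hs'⟩, rfl⟩))
        rw [map_add, map_smul, map_smul, smul_eq_mul, smul_eq_mul] at this
        exact le_neg_iff_add_nonpos_right.2 this)
    -- The new functional is `s ↦ p s + φ s * y`; with `y` on the right it is left linear even over
    -- a noncommutative `𝕜`.
    refine ⟨p + (LinearMap.toSpanSingleton 𝕜 𝕜 y).comp φ, fun w hw => by simp [hφW w hw], ?_⟩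
    intro s hs
    change p s + φ s * y ≤ 0
    rcases lt_trichotomy (φ s) 0 with h | h | h
    · have h1 := hy1 _ (Finset.mem_image_of_mem _ (Finset.mem_filter.2 ⟨hs, h⟩))
      have h2 := mul_le_mul_of_nonneg_left h1 (neg_pos.2 h).le
      rw [mul_inv_cancel_left₀ (neg_pos.2 h).ne', neg_mul] at h2
      exact le_neg_iff_add_nonpos_right.1 h2
    · rw [h, zero_mul, add_zero]
      exact hp s (Finset.mem_union_left _ (Finset.mem_filter.2 ⟨hs, h⟩))
    · have h1 := hy2 _ (Finset.mem_image_of_mem _ (Finset.mem_filter.2 ⟨hs, h⟩))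
      have h2 := mul_le_mul_of_nonneg_left h1 h.le
      rw [mul_neg, mul_inv_cancel_left₀ h.ne'] at h2
      rw [add_comm]
      exact le_neg_iff_add_nonpos_right.1 h2

/-- `W` varies in the induction: `T` is eliminated over `W ⊔ 𝕜 ∙ v`, and then `v` over `W`. -/
theorem exists_elimination_of_le_sup_span_finset (S T : Finset V) :
    ∀ W : Submodule 𝕜 V, (∀ s ∈ S, s ∈ W ⊔ Submodule.span 𝕜 (T : Set V)) →
    ∃ S' : Finset V, (∀ s ∈ S', s ∈ W ∧ NonnegComb 𝕜 (S : Set V) s) ∧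
      ∀ p : V →ₗ[𝕜] 𝕜, (∀ s ∈ S', p s ≤ 0) →
        ∃ q : V →ₗ[𝕜] 𝕜, (∀ w ∈ W, q w = p w) ∧ ∀ s ∈ S, q s ≤ 0 := by
  classical
  induction T using Finset.induction_on with
  | empty =>
    intro W hS
    exact ⟨S, fun s hs => ⟨by simpa using hS s hs, .mem hs⟩,
      fun p hp => ⟨p, fun _ _ => rfl, hp⟩⟩
  | insert v T _ ih =>
    intro W hS
    obtain ⟨S₁, h1, h2⟩ := ih (W ⊔ 𝕜 ∙ v) fun s hs => by
      have := hS s hs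
      rwa [Finset.coe_insert, Submodule.span_insert, ← sup_assoc] at this
    obtain ⟨S₂, h3, h4⟩ := exists_elimination_of_le_sup_span W v S₁ fun s hs => (h1 s hs).1
    refine ⟨S₂, fun s hs => ⟨(h3 s hs).1, .trans (fun v hv => (h1 v hv).2) (h3 s hs).2⟩, ?_⟩
    intro p hp
    obtain ⟨q, hq, hq'⟩ := h4 p hp
    obtain ⟨q', hq1, hq2⟩ := h2 q hq'
    exact ⟨q', fun w hw => (hq1 w (Submodule.mem_sup_left hw)).trans (hq w hw), hq2⟩

/-- Fourier–Motzkin elimination: the solvability of a finite system of linear inequalities, with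
prescribed values on a subspace, is expressed by finitely many inequalities that are consequences
of the system. -/
theorem exists_elimination (W : Submodule 𝕜 V) (S : Finset V) :
    ∃ S' : Finset V, (∀ s ∈ S', s ∈ W ∧ NonnegComb 𝕜 (S : Set V) s) ∧
      ∀ p : V →ₗ[𝕜] 𝕜, (∀ s ∈ S', p s ≤ 0) →
        ∃ q : V →ₗ[𝕜] 𝕜, (∀ w ∈ W, q w = p w) ∧ ∀ s ∈ S, q s ≤ 0 :=
  -- Taking the vectors of `S` themselves as the variables to eliminate avoids any finiteness
  -- condition on `V`.
  exists_elimination_of_le_sup_span_finset S S W fun _ hs =>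
    Submodule.mem_sup_right (Submodule.subset_span hs)

end Elimination

/-! ### The free vector lattice as a lattice of functions -/

namespace FreeVectorLattice

variable {𝕜 : Type*} [DivisionRing 𝕜] [LinearOrder 𝕜] [IsStrictOrderedRing 𝕜] {I : Type*}

/-- The value of an element of the free vector lattice at a point. -/
noncomputable def evalAt (p : I → 𝕜) : FreeVectorLattice 𝕜 I →ₗ[𝕜] 𝕜 :=
  (existsUnique_hom p).choose

theorem evalAt_sup (p : I → 𝕜) (x y : FreeVectorLattice 𝕜 I) :
    evalAt p (x ⊔ y) = evalAt p x ⊔ evalAt p y :=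
  (existsUnique_hom p).choose_spec.1.1 x y

theorem evalAt_inf (p : I → 𝕜) (x y : FreeVectorLattice 𝕜 I) :
    evalAt p (x ⊓ y) = evalAt p x ⊓ evalAt p y :=
  (existsUnique_hom p).choose_spec.1.2.1 x y

theorem evalAt_of (p : I → 𝕜) (i : I) : evalAt p (of 𝕜 i) = p i :=
  (existsUnique_hom p).choose_spec.1.2.2 i

theorem evalAt_mono (p : I → 𝕜) : Monotone (evalAt p) := fun x y h => by
  rw [← sup_eq_right, ← evalAt_sup, sup_eq_right.2 h]

variable (𝕜 I) in
/-- The linear forms, as elements of the free vector lattice. -/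
noncomputable def linearForm : (I →₀ 𝕜) →ₗ[𝕜] FreeVectorLattice 𝕜 I :=
  Finsupp.linearCombination 𝕜 (of 𝕜)

theorem evalAt_linearForm (p : I → 𝕜) (l : I →₀ 𝕜) :
    evalAt p (linearForm 𝕜 I l) = Finsupp.linearCombination 𝕜 p l := by
  rw [linearForm, Finsupp.apply_linearCombination]
  congr 2
  funext i
  exact evalAt_of p i

/-- Translations and nonnegative scalings distribute over joins and meets, and negation exchanges
the two, so the sublattice generated by the linear forms is already closed under the vector space
operations. -/
theorem latticeClosure_linearForm :
    latticeClosure (Set.range (linearForm 𝕜 I)) = Set.univ := by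
  set L := latticeClosure (Set.range (linearForm 𝕜 I))
  have hsub : IsSublattice L := isSublattice_latticeClosure
  have hlin : ∀ l, linearForm 𝕜 I l ∈ L := fun l => subset_latticeClosure ⟨l, rfl⟩
  have hadd1 : ∀ l, ∀ x ∈ L, linearForm 𝕜 I l + x ∈ L := by
    intro l
    refine fun x hx => latticeClosure_min (t := {x | linearForm 𝕜 I l + x ∈ L}) ?_ ⟨?_, ?_⟩ hx
    · rintro _ ⟨m, rfl⟩
      change linearForm 𝕜 I l + linearForm 𝕜 I m ∈ L
      rw [← map_add]
      exact hlin _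
    · intro x hx y hy
      change _ + _ ∈ L
      rw [add_sup]
      exact hsub.supClosed hx hy
    · intro x hx y hy
      change _ + _ ∈ L
      rw [add_inf]
      exact hsub.infClosed hx hy
  have hadd : ∀ x ∈ L, ∀ y ∈ L, x + y ∈ L := by
    intro x hx y hy
    refine latticeClosure_min (t := {x | x + y ∈ L}) ?_ ⟨?_, ?_⟩ hx
    · rintro _ ⟨m, rfl⟩
      exact hadd1 m y hy
    · intro x hx z hz
      change _ + _ ∈ L
      rw [sup_add]
      exact hsub.supClosed hx hz
    · intro x hx z hz
      change _ + _ ∈ L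
      rw [inf_add]
      exact hsub.infClosed hx hz
  have hneg : ∀ x ∈ L, -x ∈ L := by
    intro x hx
    refine latticeClosure_min (t := {x | -x ∈ L}) ?_ ⟨?_, ?_⟩ hx
    · rintro _ ⟨m, rfl⟩
      change -_ ∈ L
      rw [← map_neg]
      exact hlin _
    · intro x hx z hz
      change -_ ∈ L
      rw [neg_sup]
      exact hsub.infClosed hx hz
    · intro x hx z hz
      change -_ ∈ L
      rw [neg_inf]
      exact hsub.supClosed hx hz
  have hsmul0 : ∀ r : 𝕜, 0 ≤ r → ∀ x ∈ L, r • x ∈ L := by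
    intro r hr x hx
    refine latticeClosure_min (t := {x | r • x ∈ L}) ?_ ⟨?_, ?_⟩ hx
    · rintro _ ⟨m, rfl⟩
      change r • _ ∈ L
      rw [← map_smul]
      exact hlin _
    · intro x hx z hz
      change r • _ ∈ L
      rw [smul_sup' hr]
      exact hsub.supClosed hx hz
    · intro x hx z hz
      change r • _ ∈ L
      have : r • (x ⊓ z) = -(r • (-x ⊔ -z)) := by
        rw [← smul_neg, neg_sup, neg_neg, neg_neg]
      rw [this, smul_sup' hr, neg_sup, smul_neg, smul_neg, neg_neg, neg_neg]
      exact hsub.infClosed hx hz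
  have hsmul : ∀ r : 𝕜, ∀ x ∈ L, r • x ∈ L := by
    intro r x hx
    rcases le_total 0 r with hr | hr
    · exact hsmul0 r hr x hx
    · have := hneg _ (hsmul0 (-r) (neg_nonneg.2 hr) x hx)
      rwa [neg_smul, neg_neg] at this
  refine Set.eq_univ_of_forall fun x => ?_
  induction x using ind with | h t => ?_
  induction t with
  | var i =>
    have := hlin (Finsupp.single i 1)
    rwa [linearForm, Finsupp.linearCombination_single, one_smul] at this
  | zero =>
    have := hlin 0
    rwa [map_zero] at this
  | neg a ih => exact hneg _ ih
  | add a b iha ihb => exact hadd _ iha _ ihb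
  | smul r a ih => exact hsmul r _ ih
  | sup a b iha ihb => exact hsub.supClosed iha ihb
  | inf a b iha ihb => exact hsub.infClosed iha ihb

/-- Every element is a finite meet of finite joins of linear forms. -/
theorem induction_inf_sup {P : FreeVectorLattice 𝕜 I → Prop}
    (hsup : ∀ (M : Finset (I →₀ 𝕜)) (hM : M.Nonempty), P (M.sup' hM (linearForm 𝕜 I)))
    (hinf : ∀ x y, P x → P y → P (x ⊓ y)) (x : FreeVectorLattice 𝕜 I) : P x := by
  classical
  -- Distributivity brings every lattice combination of linear forms into the shape of a meet of
  -- joins.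
  let _ : DistribLattice (FreeVectorLattice 𝕜 I) := AddCommGroup.toDistribLattice _
  have hx : x ∈ latticeClosure (Set.range (linearForm 𝕜 I)) := by
    rw [latticeClosure_linearForm]; trivial
  rw [← infClosure_supClosure] at hx
  refine infClosure_min (t := {x | P x}) ?_ (fun a ha b hb => hinf a b ha hb) hx
  rintro _ ⟨t, ht, hts, rfl⟩
  rw [← Set.image_univ] at hts
  obtain ⟨M, -, rfl⟩ := Finset.subset_set_image_iff.1 hts
  have hM : M.Nonempty := Finset.image_nonempty.1 ht
  have := hsup M hM
  rwa [show M.sup' hM (linearForm 𝕜 I) = (M.image (linearForm 𝕜 I)).sup' ht id from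
    (Finset.sup'_image ht id).symm] at this

/-- The second coordinate records the total weight of the combination. This turns a certificate
found by elimination into an inequality in the free vector lattice, before its order is known to be
pointwise. -/
theorem le_smul_sup' {M : Finset (I →₀ 𝕜)} {hM : M.Nonempty}
    {s : (I →₀ 𝕜) × 𝕜} (hs : NonnegComb 𝕜 ((fun m => (m, (1 : 𝕜))) '' (M : Set (I →₀ 𝕜))) s) :
    linearForm 𝕜 I s.1 ≤ s.2 • M.sup' hM (linearForm 𝕜 I) := by
  induction hs with
  | mem h =>
    obtain ⟨m, hm, rfl⟩ := h
    rw [one_smul]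
    exact Finset.le_sup' (linearForm 𝕜 I) hm
  | add _ _ h1 h2 =>
    rw [Prod.fst_add, Prod.snd_add, map_add, add_smul]
    exact add_le_add h1 h2
  | smul hc _ h1 =>
    rw [Prod.smul_fst, Prod.smul_snd, map_smul, smul_eq_mul, mul_smul]
    exact smul_le_smul_of_nonneg_left h1 hc

/-- The points of `I → 𝕜` are the linear functionals on the space of linear forms. -/
theorem linearCombination_apply_single (q : (I →₀ 𝕜) →ₗ[𝕜] 𝕜) (l : I →₀ 𝕜) :
    Finsupp.linearCombination 𝕜 (fun i => q (Finsupp.single i 1)) l = q l := by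
  have : Finsupp.linearCombination 𝕜 (fun i => q (Finsupp.single i 1)) = q := by
    ext i; simp
  rw [this]

theorem evalAt_sup' (p : I → 𝕜) (M : Finset (I →₀ 𝕜)) (hM : M.Nonempty) :
    evalAt p (M.sup' hM (linearForm 𝕜 I)) = M.sup' hM (Finsupp.linearCombination 𝕜 p) := by
  rw [Finset.apply_sup'_eq_sup'_comp hM (evalAt p) (evalAt_sup p)]
  congr 1
  funext l
  exact evalAt_linearForm p l

/-- The order of the free vector lattice is pointwise. -/
theorem nonneg_of_evalAt_nonneg {x : FreeVectorLattice 𝕜 I} (h : ∀ p, 0 ≤ evalAt p x) :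
    0 ≤ x := by
  classical
  induction x using induction_inf_sup with
  | hinf x y hx hy =>
    simp only [evalAt_inf, le_inf_iff] at h
    exact le_inf (hx fun p => (h p).1) (hy fun p => (h p).2)
  | hsup M hM =>
    -- The system asks for a point where every form in `M` is at most `-1`; the extra coordinate
    -- carries the constant `1`, and everything else is eliminated. Either some consequence `(0, c)`
    -- has `c > 0`, which gives `0 ≤ c • sup M` and hence the claim, or such a point exists, against
    -- `h`.
    obtain ⟨S', h1, h2⟩ := exists_elimination (𝕜 := 𝕜)
      (LinearMap.ker (LinearMap.fst 𝕜 (I →₀ 𝕜) 𝕜)) (M.image fun m => (m, (1 : 𝕜)))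
    by_contra hcon
    have h3 : ∀ s ∈ S', LinearMap.snd 𝕜 (I →₀ 𝕜) 𝕜 s ≤ 0 := by
      intro s hs
      obtain ⟨h3, h4⟩ := h1 s hs
      rw [Finset.coe_image] at h4
      have h5 := le_smul_sup' (hM := hM) h4
      rw [show s.1 = 0 from h3, map_zero] at h5
      by_contra hneg
      have hpos : 0 < s.2 := not_le.1 hneg
      refine hcon ?_
      have := smul_nonneg (inv_nonneg.2 hpos.le) h5
      rwa [inv_smul_smul₀ hpos.ne'] at this
    obtain ⟨q, hq1, hq2⟩ := h2 _ h3
    have hq3 : q (0, 1) = 1 := hq1 (0, 1) (by simp)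
    have h6 := h fun i => q (Finsupp.single i 1, 0)
    rw [evalAt_sup'] at h6
    obtain ⟨m, hm, h7⟩ := (Finset.le_sup'_iff hM).1 h6
    have h8 := linearCombination_apply_single (q.comp (LinearMap.inl 𝕜 _ _)) m
    have h9 := hq2 (m, 1) (Finset.mem_image_of_mem _ hm)
    have h10 : q (m, 1) = q (m, 0) + q (0, 1) := by rw [← map_add]; simp
    simp only [LinearMap.comp_apply, LinearMap.inl_apply] at h8
    rw [h8] at h7
    rw [h10, hq3] at h9
    exact absurd (zero_lt_one.trans_le (le_add_of_nonneg_left h7)) (not_lt.2 h9)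

theorem le_of_evalAt_le {x y : FreeVectorLattice 𝕜 I} (h : ∀ p, evalAt p x ≤ evalAt p y) :
    x ≤ y := by
  rw [← sub_nonneg]
  refine nonneg_of_evalAt_nonneg fun p => ?_
  rw [map_sub, sub_nonneg]
  exact h p

/-- Every element of the free vector lattice is Lipschitz for the supremum norm. -/
theorem exists_lipschitz (x : FreeVectorLattice 𝕜 I) :
    ∃ r : 𝕜, 0 ≤ r ∧ ∀ (p q : I → 𝕜) (t : 𝕜), 0 ≤ t → (∀ i, |p i - q i| ≤ t) →
      |evalAt p x - evalAt q x| ≤ r * t := by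
  have hmax : ∀ {r s t : 𝕜}, 0 ≤ t → max (r * t) (s * t) ≤ max r s * t := fun ht =>
    max_le (mul_le_mul_of_nonneg_right (le_max_left _ _) ht)
      (mul_le_mul_of_nonneg_right (le_max_right _ _) ht)
  induction x using ind with | h u => ?_
  induction u with
  | var i =>
    refine ⟨1, zero_le_one, fun p q t _ h => ?_⟩
    change |evalAt p (of 𝕜 i) - evalAt q (of 𝕜 i)| ≤ _
    rw [evalAt_of, evalAt_of, one_mul]
    exact h i
  | zero =>
    refine ⟨0, le_rfl, fun p q t _ h => ?_⟩
    change |evalAt p 0 - evalAt q 0| ≤ _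
    simp
  | neg a ih =>
    obtain ⟨r, hr, h⟩ := ih
    refine ⟨r, hr, fun p q t ht hpq => ?_⟩
    change |evalAt p (-mk a) - evalAt q (-mk a)| ≤ _
    rw [map_neg, map_neg, neg_sub_neg, abs_sub_comm]
    exact h p q t ht hpq
  | add a b iha ihb =>
    obtain ⟨r, hr, h⟩ := iha
    obtain ⟨s, hs, h'⟩ := ihb
    refine ⟨r + s, add_nonneg hr hs, fun p q t ht hpq => ?_⟩
    change |evalAt p (mk a + mk b) - evalAt q (mk a + mk b)| ≤ _
    rw [map_add, map_add, add_sub_add_comm, add_mul]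
    exact (abs_add_le _ _).trans (add_le_add (h p q t ht hpq) (h' p q t ht hpq))
  | smul c a ih =>
    obtain ⟨r, hr, h⟩ := ih
    refine ⟨|c| * r, mul_nonneg (abs_nonneg c) hr, fun p q t ht hpq => ?_⟩
    change |evalAt p (c • mk a) - evalAt q (c • mk a)| ≤ _
    rw [map_smul, map_smul, smul_eq_mul, smul_eq_mul, ← mul_sub, abs_mul, mul_assoc]
    exact mul_le_mul_of_nonneg_left (h p q t ht hpq) (abs_nonneg c)
  | sup a b iha ihb =>
    obtain ⟨r, hr, h⟩ := iha
    obtain ⟨s, hs, h'⟩ := ihb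
    refine ⟨max r s, hr.trans (le_max_left _ _), fun p q t ht hpq => ?_⟩
    change |evalAt p (mk a ⊔ mk b) - evalAt q (mk a ⊔ mk b)| ≤ _
    rw [evalAt_sup, evalAt_sup]
    exact (abs_max_sub_max_le_max _ _ _ _).trans
      ((max_le_max (h p q t ht hpq) (h' p q t ht hpq)).trans (hmax ht))
  | inf a b iha ihb =>
    obtain ⟨r, hr, h⟩ := iha
    obtain ⟨s, hs, h'⟩ := ihb
    refine ⟨max r s, hr.trans (le_max_left _ _), fun p q t ht hpq => ?_⟩
    change |evalAt p (mk a ⊓ mk b) - evalAt q (mk a ⊓ mk b)| ≤ _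
    rw [evalAt_inf, evalAt_inf]
    exact (abs_min_sub_min_le_max _ _ _ _).trans
      ((max_le_max (h p q t ht hpq) (h' p q t ht hpq)).trans (hmax ht))

end FreeVectorLattice

/-! ### Distance to the zero set -/

namespace FreeVectorLattice

variable {𝕜 : Type*} [DivisionRing 𝕜] [LinearOrder 𝕜] [IsStrictOrderedRing 𝕜] {I : Type*}

/-- The bounds, in the supremum norm, on the distance from `p` to points where `x` is nonpositive. -/
def distBounds (x : FreeVectorLattice 𝕜 I) (p : I → 𝕜) : Set 𝕜 :=
  {t | 0 ≤ t ∧ ∃ q : I → 𝕜, evalAt q x ≤ 0 ∧ ∀ i, |p i - q i| ≤ t}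

/-- `g` is the distance to the set where `x` is nonpositive. -/
def IsDist (x g : FreeVectorLattice 𝕜 I) : Prop :=
  ∀ p, IsLeast (distBounds x p) (evalAt p g)

/-- The function is the join of `0` and the forms in `A`; the `0` matches the condition `0 ≤ t` in
`distBounds`. -/
theorem exists_sup_linearForm (A : Finset (I →₀ 𝕜)) :
    ∃ g : FreeVectorLattice 𝕜 I, ∀ p t, evalAt p g ≤ t ↔
      0 ≤ t ∧ ∀ l ∈ A, Finsupp.linearCombination 𝕜 p l ≤ t := by
  classical
  induction A using Finset.induction_on with
  | empty => exact ⟨0, by simp⟩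
  | insert l A _ ih =>
    obtain ⟨g, hg⟩ := ih
    refine ⟨linearForm 𝕜 I l ⊔ g, fun p t => ?_⟩
    rw [evalAt_sup, sup_le_iff, hg, evalAt_linearForm, Finset.forall_mem_insert]
    tauto

/-! ### The linear system describing the distance to a polyhedral set. -/

section System

variable (M : Finset (I →₀ 𝕜)) (J : Finset I)

open Classical in
/-- The linear system in a point `p`, a point `q` and a scalar `t` that says that the forms in `M`
are nonpositive at `q`, and the coordinates in `J` of `p` and `q` are at distance at most `t`. -/
noncomputable def distSystem : Finset ((I →₀ 𝕜) × (I →₀ 𝕜) × 𝕜) :=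
  insert (0, 0, -1) (M.image (fun m => (0, m, 0)) ∪
    (J.image (fun i => (Finsupp.single i 1, -Finsupp.single i 1, -1)) ∪
      J.image fun i => (-Finsupp.single i 1, Finsupp.single i 1, -1)))

variable {M J} in
theorem mem_distSystem {s : (I →₀ 𝕜) × (I →₀ 𝕜) × 𝕜} : s ∈ distSystem M J ↔
    s = (0, 0, -1) ∨ (∃ m ∈ M, (0, m, 0) = s) ∨
      (∃ i ∈ J, (Finsupp.single i 1, -Finsupp.single i 1, -1) = s) ∨
        ∃ i ∈ J, (-Finsupp.single i 1, Finsupp.single i 1, -1) = s := by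
  simp [distSystem]

/-- The functional given by two points and a scalar. -/
noncomputable def tripleEval (p q : I → 𝕜) (t : 𝕜) : (I →₀ 𝕜) × (I →₀ 𝕜) × 𝕜 →ₗ[𝕜] 𝕜 :=
  (Finsupp.linearCombination 𝕜 p).coprod
    ((Finsupp.linearCombination 𝕜 q).coprod (LinearMap.toSpanSingleton 𝕜 𝕜 t))

theorem tripleEval_apply (p q : I → 𝕜) (t : 𝕜) (u v : I →₀ 𝕜) (c : 𝕜) :
    tripleEval p q t (u, v, c) =
      Finsupp.linearCombination 𝕜 p u + (Finsupp.linearCombination 𝕜 q v + c * t) := rfl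

theorem exists_eq_tripleEval (P : (I →₀ 𝕜) × (I →₀ 𝕜) × 𝕜 →ₗ[𝕜] 𝕜) :
    ∃ p q t, P = tripleEval p q t := by
  refine ⟨fun i => P (Finsupp.single i 1, 0, 0), fun i => P (0, Finsupp.single i 1, 0),
    P (0, 0, 1), ?_⟩
  ext <;> simp [tripleEval]
  rfl

theorem tripleEval_single_sub (p q : I → 𝕜) (t : 𝕜) (i : I) :
    tripleEval p q t (Finsupp.single i 1, -Finsupp.single i 1, -1) = p i - q i - t := by
  simp only [tripleEval_apply, map_neg, Finsupp.linearCombination_single, one_smul, neg_mul,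
    one_mul]
  abel

theorem tripleEval_sub_single (p q : I → 𝕜) (t : 𝕜) (i : I) :
    tripleEval p q t (-Finsupp.single i 1, Finsupp.single i 1, -1) = q i - p i - t := by
  simp only [tripleEval_apply, map_neg, Finsupp.linearCombination_single, one_smul, neg_mul,
    one_mul]
  abel

theorem tripleEval_nonpos_iff {p q : I → 𝕜} {t : 𝕜} :
    (∀ s ∈ distSystem M J, tripleEval p q t s ≤ 0) ↔
      0 ≤ t ∧ (∀ m ∈ M, Finsupp.linearCombination 𝕜 q m ≤ 0) ∧ ∀ i ∈ J, |p i - q i| ≤ t := by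
  constructor
  · intro h
    refine ⟨?_, fun m hm => ?_, fun i hi => abs_sub_le_iff.2 ⟨?_, ?_⟩⟩
    · simpa [tripleEval_apply] using h _ (mem_distSystem.2 (.inl rfl))
    · simpa [tripleEval_apply] using h _ (mem_distSystem.2 (.inr (.inl ⟨m, hm, rfl⟩)))
    · rw [← sub_nonpos, ← tripleEval_single_sub]
      exact h _ (mem_distSystem.2 (.inr (.inr (.inl ⟨i, hi, rfl⟩))))
    · rw [← sub_nonpos, ← tripleEval_sub_single]
      exact h _ (mem_distSystem.2 (.inr (.inr (.inr ⟨i, hi, rfl⟩))))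
  · rintro ⟨ht, hM, hJ⟩ s hs
    rcases mem_distSystem.1 hs with rfl | ⟨m, hm, rfl⟩ | ⟨i, hi, rfl⟩ | ⟨i, hi, rfl⟩
    · simpa [tripleEval_apply] using ht
    · simpa [tripleEval_apply] using hM m hm
    · rw [tripleEval_single_sub, sub_nonpos]
      exact (abs_sub_le_iff.1 (hJ i hi)).1
    · rw [tripleEval_sub_single, sub_nonpos]
      exact (abs_sub_le_iff.1 (hJ i hi)).2

variable {M J}

/-- Both points `0` and the scalar `1` solve the system, and there a triple takes its last
coefficient as value. Hence consequences of the system bound `t` from below only. -/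
theorem scalar_nonpos_of_nonnegComb {s : (I →₀ 𝕜) × (I →₀ 𝕜) × 𝕜}
    (hs : NonnegComb 𝕜 (distSystem M J : Set ((I →₀ 𝕜) × (I →₀ 𝕜) × 𝕜)) s) : s.2.2 ≤ 0 := by
  have h := hs.map_nonpos (p := tripleEval 0 0 1)
    ((tripleEval_nonpos_iff M J).2 ⟨zero_le_one, by simp, by simp⟩)
  obtain ⟨u, v, c⟩ := s
  simpa [tripleEval_apply] using h

/-- At `q = p` and `t = 0` all rows vanish except those coming from `M`. Once `q` is eliminated,
this bounds the forms that make up the distance by multiples of the positive part. -/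
theorem exists_le_mul_of_nonnegComb (hM : M.Nonempty) {s : (I →₀ 𝕜) × (I →₀ 𝕜) × 𝕜}
    (hs : NonnegComb 𝕜 (distSystem M J : Set ((I →₀ 𝕜) × (I →₀ 𝕜) × 𝕜)) s) :
    ∃ r : 𝕜, 0 ≤ r ∧ ∀ p : I → 𝕜, Finsupp.linearCombination 𝕜 p (s.1 + s.2.1) ≤
      r * max (M.sup' hM (Finsupp.linearCombination 𝕜 p)) 0 := by
  induction hs with
  | mem hs =>
    refine ⟨1, zero_le_one, fun p => ?_⟩
    rw [one_mul]
    rcases mem_distSystem.1 hs with rfl | ⟨m, hm, rfl⟩ | ⟨i, hi, rfl⟩ | ⟨i, hi, rfl⟩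
    · simp
    · rw [zero_add]
      exact (Finset.le_sup' (Finsupp.linearCombination 𝕜 p) hm).trans (le_max_left _ _)
    · simp
    · simp
  | @add v w _ _ h1 h2 =>
    obtain ⟨r, hr, h1⟩ := h1
    obtain ⟨s, hs, h2⟩ := h2
    refine ⟨r + s, add_nonneg hr hs, fun p => ?_⟩
    rw [Prod.fst_add, Prod.snd_add, Prod.fst_add, add_add_add_comm, map_add, add_mul]
    exact add_le_add (h1 p) (h2 p)
  | @smul c v hc _ h1 =>
    obtain ⟨r, hr, h1⟩ := h1
    refine ⟨c * r, mul_nonneg hc hr, fun p => ?_⟩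
    rw [Prod.smul_fst, Prod.smul_snd, Prod.smul_fst, ← smul_add, map_smul, smul_eq_mul, mul_assoc]
    exact mul_le_mul_of_nonneg_left (h1 p) hc

end System

/-- Eliminating `q` leaves conditions `u(p) ≤ -c * t` with `c ≤ 0`. Those with `c = 0` hold at every
`p`; the others say `(-c)⁻¹ * u(p) ≤ t`. So the least admissible `t` is the join of `0` and finitely
many linear forms at `p`. -/
theorem exists_isDist_sup' (M : Finset (I →₀ 𝕜)) (hM : M.Nonempty) :
    ∃ g, IsDist (M.sup' hM (linearForm 𝕜 I)) g ∧
      ∃ r : 𝕜, 0 ≤ r ∧ g ≤ r • (M.sup' hM (linearForm 𝕜 I) ⊔ 0) := by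
  classical
  set J : Finset I := M.biUnion Finsupp.support
  obtain ⟨S, hS, hext⟩ := exists_elimination (𝕜 := 𝕜)
    (LinearMap.ker ((LinearMap.fst 𝕜 (I →₀ 𝕜) 𝕜).comp (LinearMap.snd 𝕜 (I →₀ 𝕜) _)))
    (distSystem M J)
  have hS0 : ∀ s ∈ S, s.2.1 = 0 := fun s hs => (hS s hs).1
  have hfeas : ∀ p q t, (0 ≤ t ∧ (∀ m ∈ M, Finsupp.linearCombination 𝕜 q m ≤ 0) ∧
      ∀ i ∈ J, |p i - q i| ≤ t) → ∀ s ∈ S, Finsupp.linearCombination 𝕜 p s.1 ≤ -s.2.2 * t := by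
    intro p q t h s hs
    have h1 := (hS s hs).2.map_nonpos ((tripleEval_nonpos_iff M J).2 h)
    have h2 := hS0 s hs
    obtain ⟨u, v, c⟩ := s
    obtain rfl : v = 0 := h2
    rw [tripleEval_apply, map_zero, zero_add] at h1
    rw [neg_mul]
    exact le_neg_iff_add_nonpos_right.2 h1
  have hc0 : ∀ s ∈ S, 0 ≤ -s.2.2 := fun s hs =>
    neg_nonneg.2 (scalar_nonpos_of_nonnegComb (hS s hs).2)
  -- When the coefficient of `t` is `0`, the convention `0⁻¹ = 0` makes the form zero, which is
  -- harmless in a join with `0`.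
  obtain ⟨g, hg⟩ := exists_sup_linearForm (S.image fun s => (-s.2.2)⁻¹ • s.1)
  have hg' : ∀ p t, evalAt p g ≤ t ↔
      0 ≤ t ∧ ∀ s ∈ S, (-s.2.2)⁻¹ * Finsupp.linearCombination 𝕜 p s.1 ≤ t := by
    intro p t
    rw [hg, Finset.forall_mem_image]
    simp only [map_smul, smul_eq_mul]
  refine ⟨g, fun p => ⟨?_, ?_⟩, ?_⟩
  · obtain ⟨ht, hg1⟩ := (hg' p (evalAt p g)).1 le_rfl
    have hle : ∀ s ∈ S, Finsupp.linearCombination 𝕜 p s.1 ≤ -s.2.2 * evalAt p g := by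
      intro s hs
      rcases (hc0 s hs).eq_or_lt with h0 | h0
      -- The point `q = 0` with a large scalar `T` is feasible for every `p`, so a condition without
      -- `t` holds automatically.
      · obtain ⟨T, hT⟩ := (insert 0 (J.image fun i => |p i|)).exists_le
        have h1 := hfeas p 0 T ⟨hT 0 (Finset.mem_insert_self _ _), by simp, fun i hi => by
          simpa using hT _ (Finset.mem_insert_of_mem (Finset.mem_image_of_mem _ hi))⟩ s hs
        rw [← h0, zero_mul] at h1 ⊢
        exact h1
      · have h1 := mul_le_mul_of_nonneg_left (hg1 s hs) h0.le
        rwa [mul_inv_cancel_left₀ h0.ne'] at h1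
    obtain ⟨Q, hQ1, hQ2⟩ := hext (tripleEval p 0 (evalAt p g)) (by
      intro s hs
      have h1 := hle s hs
      have h2 := hS0 s hs
      obtain ⟨u, v, c⟩ := s
      obtain rfl : v = 0 := h2
      rw [tripleEval_apply, map_zero, zero_add]
      rw [neg_mul] at h1
      exact le_neg_iff_add_nonpos_right.1 h1)
    obtain ⟨p', q, t', rfl⟩ := exists_eq_tripleEval Q
    have hp' : p' = p := by
      funext i
      simpa [tripleEval_apply] using hQ1 (Finsupp.single i 1, 0, 0) (by simp)
    have ht' : t' = evalAt p g := by
      simpa [tripleEval_apply] using hQ1 (0, 0, 1) (by simp)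
    subst hp' ht'
    obtain ⟨-, h1, h2⟩ := (tripleEval_nonpos_iff M J).1 hQ2
    -- The forms in `M` only involve coordinates in `J`; elsewhere the nearby point may copy `p'`,
    -- which controls the distance on all of `I`.
    refine ⟨ht, fun i => if i ∈ J then q i else p' i, ?_, fun i => ?_⟩
    · rw [evalAt_sup']
      refine Finset.sup'_le hM _ fun m hm => ?_
      refine le_of_eq_of_le ?_ (h1 m hm)
      rw [Finsupp.linearCombination_apply, Finsupp.linearCombination_apply]
      refine Finsupp.sum_congr fun i hi => ?_
      rw [if_pos (Finset.mem_biUnion.2 ⟨m, hm, hi⟩)]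
    · by_cases hi : i ∈ J
      · simpa [hi] using h2 i hi
      · simpa [hi] using ht
  · rintro t ⟨ht, q, hq1, hq2⟩
    rw [evalAt_sup', Finset.sup'_le_iff] at hq1
    refine (hg' p t).2 ⟨ht, fun s hs => ?_⟩
    have h1 := hfeas p q t ⟨ht, hq1, fun i _ => hq2 i⟩ s hs
    rcases (hc0 s hs).eq_or_lt with h0 | h0
    · rwa [← h0, inv_zero, zero_mul]
    · have h2 := mul_le_mul_of_nonneg_left h1 (inv_nonneg.2 h0.le)
      rwa [inv_mul_cancel_left₀ h0.ne'] at h2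
  · have hr : ∀ s ∈ S, ∃ r : 𝕜, 0 ≤ r ∧ ∀ p : I → 𝕜,
        (-s.2.2)⁻¹ * Finsupp.linearCombination 𝕜 p s.1 ≤
          r * max (M.sup' hM (Finsupp.linearCombination 𝕜 p)) 0 := by
      intro s hs
      obtain ⟨r, hr, h⟩ := exists_le_mul_of_nonnegComb hM (hS s hs).2
      refine ⟨(-s.2.2)⁻¹ * r, mul_nonneg (inv_nonneg.2 (hc0 s hs)) hr, fun p => ?_⟩
      have h1 := h p
      rw [hS0 s hs, add_zero] at h1
      rw [mul_assoc]
      exact mul_le_mul_of_nonneg_left h1 (inv_nonneg.2 (hc0 s hs))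
    choose! r hr0 hr using hr
    obtain ⟨R, hR⟩ := (insert 0 (S.image r)).exists_le
    have hR0 : 0 ≤ R := hR 0 (Finset.mem_insert_self _ _)
    refine ⟨R, hR0, le_of_evalAt_le fun p => ?_⟩
    rw [map_smul, evalAt_sup, evalAt_sup', map_zero, smul_eq_mul, hg']
    refine ⟨mul_nonneg hR0 (le_max_right _ _), fun s hs => (hr s hs p).trans ?_⟩
    exact mul_le_mul_of_nonneg_right
      (hR _ (Finset.mem_insert_of_mem (Finset.mem_image_of_mem r hs))) (le_max_right _ _)

/-- As `𝕜` is totally ordered, a meet is nonpositive on the union of the two sets, and the distance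
to a union is the smaller distance. -/
theorem IsDist.inf {x y g h : FreeVectorLattice 𝕜 I} (hx : IsDist x g) (hy : IsDist y h) :
    IsDist (x ⊓ y) (g ⊓ h) := by
  intro p
  have : distBounds (x ⊓ y) p = distBounds x p ∪ distBounds y p := by
    ext t
    simp only [distBounds, evalAt_inf, inf_le_iff, Set.mem_ofPred_eq, Set.mem_union, or_and_right,
      exists_or, and_or_left]
  rw [this, evalAt_inf]
  exact (hx p).union (hy p)

/-- The distance to the zero set exists, and it is bounded by a multiple of the positive part. -/
theorem exists_isDist (x : FreeVectorLattice 𝕜 I) :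
    ∃ g, IsDist x g ∧ ∃ r : 𝕜, 0 ≤ r ∧ g ≤ r • (x ⊔ 0) := by
  induction x using induction_inf_sup with
  | hsup M hM => exact exists_isDist_sup' M hM
  | hinf x y hx hy =>
    obtain ⟨g, hg, r, hr, hgr⟩ := hx
    obtain ⟨h, hh, s, hs, hhs⟩ := hy
    refine ⟨g ⊓ h, hg.inf hh, max r s, hr.trans (le_max_left _ _), ?_⟩
    refine le_of_evalAt_le fun p => ?_
    have h1 := (evalAt_mono p hgr).trans
      (evalAt_mono p (smul_mono_scalar (le_max_left r s) le_sup_right))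
    have h2 := (evalAt_mono p hhs).trans
      (evalAt_mono p (smul_mono_scalar (le_max_right r s) le_sup_right))
    rw [map_smul, evalAt_sup, map_zero, smul_eq_mul] at h1 h2 ⊢
    rw [evalAt_inf, evalAt_inf]
    rcases le_total (evalAt p x) (evalAt p y) with h | h
    · rw [inf_eq_left.2 h]
      exact inf_le_left.trans h1
    · rw [inf_eq_right.2 h]
      exact inf_le_right.trans h2

theorem IsDist.nonneg {x g : FreeVectorLattice 𝕜 I} (h : IsDist x g) : 0 ≤ g :=
  nonneg_of_evalAt_nonneg fun p => (h p).1.1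

/-- Compare `x` at `p` with its nonpositive value at a nearest point, using a Lipschitz constant of
`x`. -/
theorem IsDist.exists_le_smul {x g : FreeVectorLattice 𝕜 I} (h : IsDist x g) :
    ∃ r : 𝕜, 0 ≤ r ∧ x ≤ r • g := by
  obtain ⟨r, hr, hx⟩ := exists_lipschitz x
  refine ⟨r, hr, le_of_evalAt_le fun p => ?_⟩
  obtain ⟨ht, q, hq, hpq⟩ := (h p).1
  rw [map_smul, smul_eq_mul]
  have h1 := (le_abs_self _).trans (hx p q _ ht hpq)
  exact (sub_le_iff_le_add.1 h1).trans (add_le_of_nonpos_right hq)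

/-- Wherever `y` is nonpositive so is `x`, and a larger set is nearer. The factor `r` disappears,
which is why the distance depends only on the ideal. -/
theorem IsDist.mono {x y g h : FreeVectorLattice 𝕜 I} {r : 𝕜} (hx : IsDist x g) (hy : IsDist y h)
    (hr : 0 ≤ r) (hxy : x ≤ r • y) : g ≤ h := by
  refine le_of_evalAt_le fun p => (hx p).2 ?_
  obtain ⟨ht, q, hq, hpq⟩ := (hy p).1
  refine ⟨ht, q, (evalAt_mono q hxy).trans ?_, hpq⟩
  rw [map_smul]
  exact mul_nonpos_of_nonneg_of_nonpos hr hq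

end FreeVectorLattice

/-! ### An isotone choice of generators

The supremum-norm distance to the set where `x` is nonpositive depends only on the principal
`ℓ`-ideal of `x ≥ 0`, generates it, and is isotone. No cardinality assumption is needed. -/

namespace PrincipalLIdeal

variable {𝕜 : Type*} [DivisionRing 𝕜] [LinearOrder 𝕜] [IsStrictOrderedRing 𝕜] {I : Type*}

open FreeVectorLattice in
theorem exists_monotone_generator : ∃ γ : PrincipalLIdeal 𝕜 (FreeVectorLattice 𝕜 I) →
    FreeVectorLattice 𝕜 I, Monotone γ ∧ (∀ J, 0 ≤ γ J) ∧ ∀ J, PrincipalLIdeal.mk 𝕜 (γ J) = J := by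
  choose γ hγ r hr hγr using fun J : PrincipalLIdeal 𝕜 (FreeVectorLattice 𝕜 I) =>
    exists_isDist (gen J)
  refine ⟨γ, fun J K h => ?_, fun J => (hγ J).nonneg, fun J => ?_⟩
  · rw [← mk_gen J, ← mk_gen K] at h
    obtain ⟨s, hs, hle⟩ := mk_le_mk.1 h
    rw [abs_of_nonneg (gen_nonneg J), abs_of_nonneg (gen_nonneg K)] at hle
    exact (hγ J).mono (hγ K) hs hle
  · conv_rhs => rw [← mk_gen J]
    apply le_antisymm
    · refine mk_le_mk.2 ⟨r J, hr J, ?_⟩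
      have := hγr J
      rwa [sup_eq_left.2 (gen_nonneg J), ← abs_of_nonneg (gen_nonneg J),
        ← abs_of_nonneg (hγ J).nonneg] at this
    · obtain ⟨s, hs, hle⟩ := (hγ J).exists_le_smul
      refine mk_le_mk.2 ⟨s, hs, ?_⟩
      rwa [abs_of_nonneg (gen_nonneg J), abs_of_nonneg (hγ J).nonneg]

/-- An isotone choice of nonnegative generators yields a monotone Cevian deviation. -/
theorem monotoneCevian_of_monotone_generator {E : Type*} [AddCommGroup E] [Lattice E]
    [IsOrderedAddMonoid E] [Module 𝕜 E] [PosSMulMono 𝕜 E] (γ : PrincipalLIdeal 𝕜 E → E)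
    (hmono : Monotone γ) (h0 : ∀ J, 0 ≤ γ J) (hmk : ∀ J, PrincipalLIdeal.mk 𝕜 (γ J) = J) :
    MonotoneCevian (PrincipalLIdeal 𝕜 E) := by
  have hpos : ∀ x : E, 0 ≤ x ⊔ 0 := fun x => le_sup_right
  -- The join of the ideals is generated by `y ⊔ z`, and `y + z` is at most twice that.
  have hadd : ∀ {x y z : E}, 0 ≤ x → 0 ≤ y → 0 ≤ z → x ≤ y + z →
      PrincipalLIdeal.mk 𝕜 x ≤ PrincipalLIdeal.mk 𝕜 y ⊔ PrincipalLIdeal.mk 𝕜 z := by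
    intro x y z hx hy hz h
    rw [mk_sup_mk hy hz]
    have hyz : 0 ≤ y ⊔ z := hy.trans le_sup_left
    refine mk_le_mk.2 ⟨1 + 1, add_nonneg zero_le_one zero_le_one, ?_⟩
    rw [abs_of_nonneg hx, abs_of_nonneg hyz, add_smul, one_smul]
    exact h.trans (add_le_add le_sup_left le_sup_right)
  refine ⟨fun x y => PrincipalLIdeal.mk 𝕜 ((γ x - γ y) ⊔ 0), ⟨fun x y => ?_, fun x y => ?_⟩,
    ⟨fun x x' y h => ?_, fun x y y' h => ?_⟩, fun x y z => ?_⟩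
  · have := hadd (h0 x) (h0 y) (hpos (γ x - γ y)) (by
      rw [← sub_le_iff_le_add']; exact le_sup_left)
    rwa [hmk, hmk] at this
  · rw [mk_inf_mk (hpos _) (hpos _)]
    have : ((γ x - γ y) ⊔ 0) ⊓ ((γ y - γ x) ⊔ 0) = 0 := by
      rw [← neg_sub (γ x) (γ y)]
      exact posPart_inf_negPart_eq_zero (γ x - γ y)
    rw [this]
    rfl
  · exact mk_le_mk_of_le (hpos _) (sup_le_sup_right (sub_le_sub_right (hmono h) _) _)
  · exact mk_le_mk_of_le (hpos _) (sup_le_sup_right (sub_le_sub_left (hmono h) _) _)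
  · refine hadd (hpos _) (hpos _) (hpos _) (sup_le ?_ (add_nonneg (hpos _) (hpos _)))
    rw [← sub_add_sub_cancel (γ x) (γ y) (γ z)]
    exact add_le_add le_sup_left le_sup_left

end PrincipalLIdeal

theorem corollaryC (I : Type*) (𝕜 : Type*) [DivisionRing 𝕜] [LinearOrder 𝕜]
    [IsStrictOrderedRing 𝕜] [Countable 𝕜] :
    MonotoneCevian (PrincipalLIdeal 𝕜 (FreeVectorLattice 𝕜 I)) := by
  obtain ⟨γ, hmono, h0, hmk⟩ :=
    PrincipalLIdeal.exists_monotone_generator (𝕜 := 𝕜) (I := I)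
  exact PrincipalLIdeal.monotoneCevian_of_monotone_generator γ hmono h0 hmk
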